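/- **Setting.** Let $\Sigma_N=\{-1,1\}^N$, $R(\sigma,\tau)=\frac1N\sum_i\sigma_i\tau_i$, and let $(H_N(\sigma))_{\sigma\in\Sigma_N}$ be the Hamiltonian of a generic mixed $p$-spin model: a centered Gaussian process with covariance $\mathbb E H_N(\sigma)H_N(\tau)=N\xi(R(\sigma,\tau))$, where $\xi(t)=\sum_{p\ge2}\beta_pt^p$ with $\beta_p\ge0$ summable, and where the constants together with the powers $t^p$, $\beta_p>0$, span a dense subspace of $(C([-1,1]),\sup|\cdot|)$. Let $h\in\mathbb R$, let $\mu_N(\{\sigma\})\propto\exp(H_N(\sigma)+h\sum_i\sigma_i)$ be the Gibbs measure, let $\zeta_N(A)=\mathbb E\,\mu_N^{\otimes2}(R(\sigma^1,\sigma^2)\in A)$, let the probability measure $\zeta$ be the weak limit of $\zeta_N$, and let $q_*=\sup\operatorname{supp}\zeta$. Assume $\zeta(\{q_*\})>0$. **Cluster collections.** A family of random subsets $C_{\alpha}=C_{\alpha,N}\subset\Sigma_N$, $\alpha\in\mathbb N$, is called a *cluster collection* with deterministic real sequences $q_N,a_N,b_N,\epsilon_N$ and integers $m_N$ if the following hold.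 The sequence $q_N$ is nondecreasing with limit $q_*$; the sequences $a_N,b_N,\epsilon_N$ are nonincreasing with limit $0$; $m_N\to\infty$ and $m_Nb_N^\gamma\to0$ for some $\gamma\in(0,1]$; for all large $N$, $q_N+a_N<q_*$ and $\zeta_N([q_N+a_N,1])\ge\zeta(\{q_*\})-b_N$. Moreover there is a deterministic sequence $\delta_N\to0$ such that, with probability $1-o(1)$ as $N\to\infty$, the sets $C_\alpha$ are pairwise disjoint, $\mu_N(C_1)\ge\mu_N(C_2)\ge\cdots$, and 1. $\sum_\alpha\mu_N(C_\alpha)\ge1-\epsilon_N$; 2. for every $\alpha$, $\mu_N^{\otimes2}(\sigma^1,\sigma^2\in C_\alpha:\ R(\sigma^1,\sigma^2)\le q_N-a_N)\le b_N$; 3. for all $\alpha\ne\alpha'$, $\mu_N^{\otimes2}(\sigma^1\in C_\alpha,\sigma^2\in C_{\alpha'}:\ R(\sigma^1,\sigma^2)\ge q_N+a_N)\le b_N$; 4. for every $\alpha$, $\int_{C_\alpha\times C_\alpha}|R(\sigma^1,\sigma^2)-q_*|\,d\mu_N^{\otimes2}\le\delta_N$; and finally 5. the sequence $(\mu_N(C_\alpha))_{\alpha}$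 converges in distribution (in the topology of coordinatewise convergence) to the ranked weights of a Poisson–Dirichlet process of parameter $\theta=1-\zeta(\{q_*\})$, that is, to the decreasingly ordered normalized points of a Poisson process on $(0,\infty)$ with intensity $\theta x^{-1-\theta}dx$ if $\theta\in(0,1)$, and to $(1,0,0,\dots)$ if $\theta=0$. **Theorem (Essential uniqueness).** Let $\{C_\alpha\}$ and $\{X_\alpha\}$ be two cluster collections for the same model, with sequences $(q_N,a_N,b_N,\epsilon_N,m_N)$ and $(q_N',a_N',b_N',\epsilon_N',m_N')$ respectively. Suppose that $$\zeta_N\big([q_N'-a_N',\,q_N+a_N]\big)+\zeta_N\big([q_N-a_N,\,q_N'+a_N']\big)\to0 ,$$ where $[x,y]=\emptyset$ if $x>y$. Then for each $\alpha\in\mathbb N$, $\mu_N(C_\alpha\,\Delta\,X_\alpha)\to0$ in probability. -/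

import Mathlib

open MeasureTheory ProbabilityTheory Filter Topology
open scoped symmDiff

namespace SpinGlass

noncomputable section

/-! ### The model -/

/-- The hypercube `Σ_N = {-1, 1}^N`. -/
abbrev Config (N : ℕ) : Type := Fin N → ℤˣ

/-- The `i`-th spin as a real number. -/
def spin {N : ℕ} (σ : Config N) (i : Fin N) : ℝ := ((σ i : ℤ) : ℝ)

/-- The overlap `R(σ, τ) = N⁻¹ ∑ σ_i τ_i`. -/
def overlap {N : ℕ} (σ τ : Config N) : ℝ := (∑ i, spin σ i * spin τ i) / N

/-- The function `ξ(t) = ∑_{p ≥ 2} β_p t^p`. -/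
def xi (β : ℕ → ℝ) (t : ℝ) : ℝ := ∑' p : ℕ, β (p + 2) * t ^ (p + 2)

/-- The power function `t ↦ t ^ p` on `[-1, 1]`. -/
def powerFun (p : ℕ) : C(Set.Icc (-1 : ℝ) 1, ℝ) := ⟨fun t => (t : ℝ) ^ p, by fun_prop⟩

/-- Genericity: the constants and the powers `t ^ p`, `p ≥ 2`, with `β_p > 0` span a dense subspace
of `C([-1, 1])` for the sup norm. -/
def IsGeneric (β : ℕ → ℝ) : Prop :=
  (Submodule.span ℝ (powerFun '' ({0} ∪ {p | 2 ≤ p ∧ 0 < β p}))).topologicalClosure = ⊤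

/-- `H N` is a centered Gaussian process on `Σ_N` with covariance `N ξ(R)`, where
`ξ(t) = ∑_{p ≥ 2} β_p t^p` is generic with summable nonnegative coefficients. -/
structure IsGenericMixedPSpin {Ω : Type*} [MeasurableSpace Ω] (P : Measure Ω) (β : ℕ → ℝ)
    (H : (N : ℕ) → Config N → Ω → ℝ) : Prop where
  coeff_nonneg : ∀ p, 2 ≤ p → 0 ≤ β p
  coeff_summable : Summable β
  generic : IsGeneric β
  gaussian : ∀ N, IsGaussianProcess (H N) P
  centered : ∀ N σ, ∫ ω, H N σ ω ∂P = 0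
  covariance : ∀ N σ τ, ∫ ω, H N σ ω * H N τ ω ∂P = N * xi β (overlap σ τ)

/-- The energy `E(σ) + h ∑ σ_i` with external field `h`. -/
def energy {N : ℕ} (h : ℝ) (E : Config N → ℝ) (σ : Config N) : ℝ := E σ + h * ∑ i, spin σ i

/-- The Gibbs probability `μ_N({σ})` for the Hamiltonian `E` and external field `h`. -/
def gibbs {N : ℕ} (h : ℝ) (E : Config N → ℝ) (σ : Config N) : ℝ :=
  Real.exp (energy h E σ) / ∑ τ, Real.exp (energy h E τ)

/-- The mass `μ(A)` of a set for the measure on the finite set `Σ_N` with point masses `w`. -/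
def mass {N : ℕ} (w : Config N → ℝ) (A : Finset (Config N)) : ℝ := ∑ σ ∈ A, w σ

open Classical in
/-- `μ^{⊗2}(σ¹ ∈ A, σ² ∈ B : R(σ¹, σ²) ∈ S)` for the measure with point masses `w`. -/
def pairMass {N : ℕ} (w : Config N → ℝ) (A B : Finset (Config N)) (S : Set ℝ) : ℝ :=
  ∑ σ ∈ A, ∑ τ ∈ B, if overlap σ τ ∈ S then w σ * w τ else 0

/-- The overlap distribution `ζ_N(S) = E μ_N^{⊗2}(R(σ¹, σ²) ∈ S)`, as a measure on `ℝ`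
(carried by `[-1, 1]`): the pair `(σ, τ)` contributes the mass `E [μ_N(σ) μ_N(τ)]` at its
overlap. -/
def overlapLaw {Ω : Type*} [MeasurableSpace Ω] (P : Measure Ω) (h : ℝ)
    (H : (N : ℕ) → Config N → Ω → ℝ) (N : ℕ) : Measure ℝ :=
  ∑ σ : Config N, ∑ τ : Config N,
    ENNReal.ofReal (∫ ω, gibbs h (fun ρ => H N ρ ω) σ * gibbs h (fun ρ => H N ρ ω) τ ∂P) •
      Measure.dirac (overlap σ τ)

/-- `ζ` is the limiting overlap distribution: the weak limit of the overlap distributions `ζ_N`. -/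
def IsLimitingOverlapLaw {Ω : Type*} [MeasurableSpace Ω] (P : Measure Ω) (h : ℝ)
    (H : (N : ℕ) → Config N → Ω → ℝ) (ζ : Measure ℝ) : Prop :=
  ∀ f : BoundedContinuousFunction ℝ ℝ,
    Tendsto (fun N => ∫ x, f x ∂(overlapLaw P h H N)) atTop (𝓝 (∫ x, f x ∂ζ))

/-- `q_* = sup supp ζ`. -/
def qStar (ζ : Measure ℝ) : ℝ := sSup ζ.support

/-! ### The Poisson–Dirichlet process -/

/-- The law of an i.i.d. sequence of standard exponential variables. -/
def expSeqLaw : Measure (ℕ → ℝ) := Measure.infinitePi (fun _ : ℕ => expMeasure 1)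

instance : IsProbabilityMeasure expSeqLaw := by
  have : ∀ _ : ℕ, IsProbabilityMeasure (expMeasure 1) :=
    fun _ => isProbabilityMeasure_expMeasure one_pos
  unfold expSeqLaw
  infer_instance

/-- The `n`-th largest point `Γ_n ^ (-1/θ)`, with `Γ_n = e_0 + ⋯ + e_n`, of a Poisson point process
on `(0, ∞)` with intensity `θ x ^ (-1 - θ) dx`, when `e` is a sequence of i.i.d. standard
exponential variables and `0 < θ < 1`. -/
def poissonPoint (θ : ℝ) (e : ℕ → ℝ) (n : ℕ) : ℝ :=
  (∑ i ∈ Finset.range (n + 1), e i) ^ (-1 / θ)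

/-- The ranked normalized points of the Poisson process of intensity `θ x ^ (-1 - θ) dx`. -/
def pdWeight (θ : ℝ) (e : ℕ → ℝ) (n : ℕ) : ℝ :=
  poissonPoint θ e n / ∑' k, poissonPoint θ e k

theorem measurable_pdWeight (θ : ℝ) : Measurable (pdWeight θ) := by
  have h : ∀ n, Measurable (fun e : ℕ → ℝ => poissonPoint θ e n) := by
    intro n
    unfold poissonPoint
    fun_prop
  refine measurable_pi_iff.2 fun n => ?_
  exact (h n).div (Measurable.tsum h)

open Classical in
/-- The law of the decreasingly ordered weights of a Poisson–Dirichlet process of parameter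
`θ ∈ [0, 1)`. For `θ ∈ (0, 1)` it is the law of the ranked normalized points of a Poisson process of
intensity `θ x ^ (-1 - θ) dx`; for `θ = 0` it is the degenerate law on `(1, 0, 0, …)`. -/
def poissonDirichlet (θ : ℝ) : Measure (ℕ → ℝ) :=
  if θ = 0 then Measure.dirac (Pi.single 0 1) else expSeqLaw.map (pdWeight θ)

instance (θ : ℝ) : IsProbabilityMeasure (poissonDirichlet θ) := by
  unfold poissonDirichlet
  split_ifs
  · infer_instance
  · exact Measure.isProbabilityMeasure_map (measurable_pdWeight θ).aemeasurable

/-! ### Cluster properties -/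

/-- The deterministic sequences `q_N, a_N, b_N, ε_N, m_N` attached to a collection of clusters. -/
structure Scales where
  q : ℕ → ℝ
  a : ℕ → ℝ
  b : ℕ → ℝ
  ε : ℕ → ℝ
  m : ℕ → ℕ

/-- The requirements on the sequences, relative to the overlap distributions `ζN` and
their limit `ζ`. -/
structure Scales.Admissible (s : Scales) (ζN : ℕ → Measure ℝ) (ζ : Measure ℝ) : Prop where
  q_mono : Monotone s.q
  q_tendsto : Tendsto s.q atTop (𝓝 (qStar ζ))
  a_anti : Antitone s.a
  a_tendsto : Tendsto s.a atTop (𝓝 0)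
  b_anti : Antitone s.b
  b_tendsto : Tendsto s.b atTop (𝓝 0)
  ε_anti : Antitone s.ε
  ε_tendsto : Tendsto s.ε atTop (𝓝 0)
  m_tendsto : Tendsto s.m atTop atTop
  m_b_tendsto : ∃ γ : ℝ, 0 < γ ∧ γ ≤ 1 ∧
    Tendsto (fun N => (s.m N : ℝ) * s.b N ^ γ) atTop (𝓝 0)
  add_lt : ∀ᶠ N in atTop, s.q N + s.a N < qStar ζ
  top_mass : ∀ᶠ N in atTop,
    ζ.real {qStar ζ} - s.b N ≤ (ζN N).real (Set.Icc (s.q N + s.a N) 1)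

/-- The properties, for one realization of the disorder at size `N`, of a sequence `C` of subsets
of `Σ_N`: disjointness, exhaustion, closeness within clusters, separation between clusters, overlap
concentration at `qs`, and the decreasing order of the masses. Here `w` are the point masses of the
Gibbs measure and `δ` is the bound in the overlap concentration. -/
structure ClusterProperties {N : ℕ} (w : Config N → ℝ) (s : Scales) (qs δ : ℝ)
    (C : ℕ → Finset (Config N)) : Prop where
  disjoint : ∀ α α', α ≠ α' → Disjoint (C α) (C α')
  exhaust : 1 - s.ε N ≤ ∑' α, mass w (C α)
  close : ∀ α, pairMass w (C α) (C α) (Set.Iic (s.q N - s.a N)) ≤ s.b N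
  separated : ∀ α α', α ≠ α' →
    pairMass w (C α) (C α') (Set.Ici (s.q N + s.a N)) ≤ s.b N
  concentrated : ∀ α, ∑ σ ∈ C α, ∑ τ ∈ C α, |overlap σ τ - qs| * (w σ * w τ) ≤ δ
  ordered : Antitone fun α => mass w (C α)

/-- The random sets `C N α ω ⊆ Σ_N`, `α ∈ ℕ`, are clusters at scales `s`: the deterministic
sequences are as required, with probability `1 - o(1)` the sets have the properties above
(with a deterministic bound `δ N → 0` for the overlap concentration), and the sequence of their masses converges in distribution
(for the product topology, which on mass partitions is the usual one) to the weights of a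
Poisson–Dirichlet process of parameter `1 - ζ({q_*})`. -/
structure IsClusterCollection {Ω : Type*} [MeasurableSpace Ω] (P : Measure Ω)
    [IsProbabilityMeasure P] (h : ℝ) (H : (N : ℕ) → Config N → Ω → ℝ) (ζ : Measure ℝ)
    (s : Scales) (C : (N : ℕ) → ℕ → Ω → Finset (Config N)) : Prop where
  admissible : s.Admissible (overlapLaw P h H) ζ
  measurable : ∀ N α σ, MeasurableSet {ω | σ ∈ C N α ω}
  whp : ∃ δ : ℕ → ℝ, Tendsto δ atTop (𝓝 0) ∧
    Tendsto (fun N => P {ω | ¬ ClusterProperties (gibbs h (fun ρ => H N ρ ω)) s (qStar ζ) (δ N)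
      (fun α => C N α ω)}) atTop (𝓝 0)
  weights : TendstoInDistribution
    (fun N ω α => mass (gibbs h (fun ρ => H N ρ ω)) (C N α ω)) atTop
    (id : (ℕ → ℝ) → (ℕ → ℝ)) (fun _ => P) (poissonDirichlet (1 - ζ.real {qStar ζ}))

end

end SpinGlass

open SpinGlass

/-! Pairs inside a cluster `C_k` with overlap below `q_N - a_N` have small mass, and so do pairs
from two different clusters `X_i`, `X_j` with overlap above `q_N' + a_N'`. A pair in `(C_k ∩ X_i) ×
(C_k ∩ X_j)` is of one of these kinds or has its overlap in the window `[q_N - a_N, q_N' + a_N']`,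
whose mass vanishes. So `μ(C_k ∩ X_i) μ(C_k ∩ X_j)` is small for `i ≠ j`. Since a fixed number `M`
of the `X_i` carry almost all the mass, a `C_k` of non-negligible mass lies almost entirely in one
of them (`exists_mass_sub_le_mass_inter`). The other window gives the same with the families
exchanged.

It remains to see that the matching respects ranks. This is combinatorial (`diagonal_matching`) and
only needs a definite gap between the first masses of one family. The gap and the choice of `M` come
from the Poisson–Dirichlet limit, whose weights sum to 1 and, for `θ > 0`, strictly decrease; both
are passed to large `N` through open sets of finitely many coordinates. For `θ = 0` only the top
rank has a gap, and the other clusters are negligible. -/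

namespace SpinGlass

/-! ### Matching of almost coinciding ranked partitions -/

/-- If nonnegative numbers `v i` almost add up to `a` while the products of distinct ones are small,
then one of them is close to `a`. -/
theorem exists_sub_le_of_mul_le {v : ℕ → ℝ} {M : ℕ} {a y η κ ρ : ℝ} (hM : 0 < M)
    (hv : ∀ i, 0 ≤ v i) (hle : ∑ i ∈ Finset.range M, v i ≤ a)
    (hge : a ≤ ∑ i ∈ Finset.range M, v i + η) (ha : a ≤ 1) (hκ : 0 ≤ κ)
    (hcross : ∀ i < M, ∀ j < M, i ≠ j → v i * v j ≤ κ) (hy : 0 < y) (hya : y ≤ a)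
    (hsmall : (M : ℝ) ^ 2 * κ + 2 * η ≤ ρ * y) : ∃ i, a - ρ ≤ v i := by
  obtain ⟨t, -, htmax⟩ := Finset.exists_max_image (Finset.range M) v ⟨0, by simpa using hM⟩
  refine ⟨t, ?_⟩
  set S := ∑ i ∈ Finset.range M, v i with hS
  have hS0 : 0 ≤ S := Finset.sum_nonneg fun i _ => hv i
  -- Expand the square: the diagonal is at most `v t * S`, since `v t` is the maximum, and each of
  -- the at most `M ^ 2` remaining products is at most `κ`.
  have hsq : S * S ≤ v t * a + (M : ℝ) ^ 2 * κ := by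
    have h1 : S * S = ∑ i ∈ Finset.range M, ∑ j ∈ Finset.range M, v i * v j := by
      rw [hS, Finset.sum_mul_sum]
    have h2 : ∀ i ∈ Finset.range M, ∑ j ∈ Finset.range M, v i * v j ≤ v i * v t + M * κ := by
      intro i hi
      calc ∑ j ∈ Finset.range M, v i * v j
          ≤ ∑ j ∈ Finset.range M, ((if i = j then v i * v t else 0) + κ) := by
            refine Finset.sum_le_sum fun j hj => ?_
            split_ifs with hij
            · have := mul_le_mul_of_nonneg_left (htmax j hj) (hv i)
              linarith
            · have := hcross i (Finset.mem_range.1 hi) j (Finset.mem_range.1 hj) hij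
              linarith
        _ = v i * v t + M * κ := by
            rw [Finset.sum_add_distrib, Finset.sum_ite_eq, if_pos hi]
            simp
    calc S * S ≤ ∑ i ∈ Finset.range M, (v i * v t + M * κ) := by
          rw [h1]; exact Finset.sum_le_sum h2
      _ = S * v t + (M : ℝ) ^ 2 * κ := by
          rw [Finset.sum_add_distrib, ← Finset.sum_mul]
          simp only [Finset.sum_const, Finset.card_range, nsmul_eq_mul]
          ring
      _ ≤ v t * a + (M : ℝ) ^ 2 * κ := by
          have := mul_le_mul_of_nonneg_left hle (hv t)
          linarith
  have hη0 : 0 ≤ η := by linarith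
  -- `a² - S² = (a - S)(a + S)`, with `a - S ≤ η` and `a + S ≤ 2`.
  have hprod : a * a ≤ S * S + 2 * η := by
    nlinarith [mul_nonneg (show 0 ≤ S + η - a by linarith) (show 0 ≤ a + S by linarith),
      mul_nonneg hη0 (show 0 ≤ 2 - (a + S) by linarith)]
  have ha0 : 0 < a := hy.trans_le hya
  have hρ : 0 ≤ ρ := by
    have : 0 ≤ ρ * y := le_trans (by positivity) hsmall
    exact nonneg_of_mul_nonneg_left this hy
  have hmul : a * (a - ρ) ≤ a * v t := by
    have := mul_le_mul_of_nonneg_left hya hρ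
    linarith
  exact le_of_mul_le_mul_left hmul ha0

/-- Two ranked mass partitions, with masses `c`, `x` and masses `m k j` of the intersections, such
that every non-negligible part of each is almost contained in a part of the other, match along the
diagonal as long as the ranking of `c` is strict with a definite gap. -/
theorem diagonal_matching {m : ℕ → ℕ → ℝ} {c x : ℕ → ℝ} {g ρ : ℝ} {α : ℕ}
    (hm : ∀ k j, 0 ≤ m k j)
    (hrow : ∀ k i j, i ≠ j → m k i + m k j ≤ c k) (hcol : ∀ j k l, k ≠ l → m k j + m l j ≤ x j)
    (hc : Antitone c) (hx : Antitone x)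
    (hbestc : ∀ k, g / 2 ≤ c k → ∃ j, c k - ρ ≤ m k j)
    (hbestx : ∀ j, g / 2 ≤ x j → ∃ k, x j - ρ ≤ m k j)
    (hgap : ∀ k ≤ α, g ≤ c k - c (k + 1)) (hρ : 0 < ρ) (hρg : 4 * ρ < g) :
    ∀ k ≤ α, c k - ρ ≤ m k k ∧ x k - ρ ≤ m k k := by
  have hrow1 : ∀ k j, m k j ≤ c k := fun k j => by
    have h1 := hrow k j (j + 1) (by omega)
    have h2 := hm k (j + 1)
    linarith
  have hcol1 : ∀ k j, m k j ≤ x j := fun k j => by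
    have h1 := hcol j k (k + 1) (by omega)
    have h2 := hm (k + 1) j
    linarith
  have hc0 : ∀ k, 0 ≤ c k := fun k => (hm k 0).trans (hrow1 k 0)
  have hcg : ∀ k ≤ α, g ≤ c k := fun k hk => by linarith [hgap k hk, hc0 (k + 1)]
  -- Matching is mutual: `x j` is large, so it is almost filled by some row; a row other than `k`
  -- would leave no room for `m k j ≥ c k - ρ`.
  have hback : ∀ k ≤ α, ∀ j, c k - ρ ≤ m k j → x j - ρ ≤ m k j := by
    intro k hk j hkj
    have h1 := hcg k hk
    have h2 := hcol1 k j
    obtain ⟨l, hl⟩ := hbestx j (by linarith)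
    by_cases hlk : k = l
    · rwa [hlk]
    · have := hcol j k l hlk
      linarith
  intro k
  induction k using Nat.strong_induction_on with
  | _ k ih =>
    intro hk
    obtain ⟨j, hj⟩ := hbestc k (by linarith [hcg k hk])
    have hkg := hcg k hk
    rcases lt_trichotomy j k with hjk | hjk | hjk
    -- Column `j` is already almost filled by row `j`.
    · have h1 := (ih j hjk (hjk.le.trans hk)).2
      have h2 := hcol j j k hjk.ne
      linarith
    · subst hjk
      exact ⟨hj, hback j hk j hj⟩
    -- Here `x k ≥ x j ≥ c k - ρ`, so column `k` also needs a partner row `l`. A row `l < k` is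
    -- already used by column `l`, row `k` is used by column `j`, and a row `l > k` has mass at most
    -- `c k - g`, too small. Only the last case needs the gap between consecutive masses.
    · exfalso
      have h1 : x j ≤ x k := hx hjk.le
      have h2 := hcol1 k j
      obtain ⟨l, hl⟩ := hbestx k (by linarith)
      rcases lt_trichotomy l k with hlk | hlk | hlk
      · have h3 := (ih l hlk (hlk.le.trans hk)).1
        have h4 := hrow l l k hlk.ne
        linarith
      · subst hlk
        have h3 := hrow l l j hjk.ne
        linarith
      · have h3 : c l ≤ c (k + 1) := hc hlk
        have h4 := hrow1 l k
        have h5 := hgap k hk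
        linarith

/-! ### Masses of sets and of pairs -/

section Mass

variable {N : ℕ} {w : Config N → ℝ}

theorem mass_nonneg (hw : ∀ σ, 0 ≤ w σ) (A : Finset (Config N)) : 0 ≤ mass w A :=
  Finset.sum_nonneg fun σ _ => hw σ

theorem mass_mono (hw : ∀ σ, 0 ≤ w σ) {A B : Finset (Config N)} (h : A ⊆ B) :
    mass w A ≤ mass w B :=
  Finset.sum_le_sum_of_subset_of_nonneg h fun σ _ _ => hw σ

theorem mass_le_one (hw : ∀ σ, 0 ≤ w σ) (h1 : mass w Finset.univ = 1) (A : Finset (Config N)) :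
    mass w A ≤ 1 :=
  h1 ▸ mass_mono hw (Finset.subset_univ A)

theorem mass_symmDiff (A B : Finset (Config N)) :
    mass w (A ∆ B) = (mass w A - mass w (A ∩ B)) + (mass w B - mass w (A ∩ B)) := by
  have h1 : mass w (A \ B) + mass w (A ∩ B) = mass w A := by
    have := Finset.sum_inter_add_sum_sdiff A B w
    unfold mass; linarith
  have h2 : mass w (B \ A) + mass w (A ∩ B) = mass w B := by
    have := Finset.sum_inter_add_sum_sdiff B A w
    rw [Finset.inter_comm B A] at this
    unfold mass; linarith
  have h3 : mass w (A ∆ B) = mass w (A \ B) + mass w (B \ A) := by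
    unfold mass
    rw [symmDiff, Finset.sup_eq_union, Finset.sum_union disjoint_sdiff_sdiff]
  linarith

theorem mass_inter_add_le (hw : ∀ σ, 0 ≤ w σ) (A : Finset (Config N)) {B B' : Finset (Config N)}
    (h : Disjoint B B') : mass w (A ∩ B) + mass w (A ∩ B') ≤ mass w A := by
  have hd : Disjoint (A ∩ B) (A ∩ B') :=
    h.mono Finset.inter_subset_right Finset.inter_subset_right
  unfold mass
  rw [← Finset.sum_union hd]
  exact mass_mono hw (Finset.union_subset Finset.inter_subset_left Finset.inter_subset_left)

theorem pairMass_mono (hw : ∀ σ, 0 ≤ w σ) {A A' B B' : Finset (Config N)} (hA : A ⊆ A')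
    (hB : B ⊆ B') (S : Set ℝ) : pairMass w A B S ≤ pairMass w A' B' S := by
  classical
  have h0 : ∀ σ τ, 0 ≤ if overlap σ τ ∈ S then w σ * w τ else 0 := fun σ τ => by
    split_ifs
    · exact mul_nonneg (hw σ) (hw τ)
    · exact le_rfl
  unfold pairMass
  refine (Finset.sum_le_sum fun σ _ => ?_).trans
    (Finset.sum_le_sum_of_subset_of_nonneg hA fun σ _ _ => Finset.sum_nonneg fun τ _ => ?_)
  · exact Finset.sum_le_sum_of_subset_of_nonneg hB fun τ _ _ => by convert h0 σ τ
  · convert h0 σ τ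

theorem pairMass_nonneg (hw : ∀ σ, 0 ≤ w σ) (A B : Finset (Config N)) (S : Set ℝ) :
    0 ≤ pairMass w A B S := by
  simpa [pairMass] using
    pairMass_mono hw (Finset.empty_subset A) (Finset.empty_subset B) S

/-- The product of the masses of two parts of `A` is bounded by splitting the pairs according to
whether their overlap is at most `u`, at least `v` or in between. -/
theorem mass_inter_mul_mass_inter_le (hw : ∀ σ, 0 ≤ w σ) (A B B' : Finset (Config N)) (u v : ℝ) :
    mass w (A ∩ B) * mass w (A ∩ B') ≤ pairMass w A A (Set.Iic u) + pairMass w B B' (Set.Ici v) +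
      pairMass w Finset.univ Finset.univ (Set.Icc u v) := by
  classical
  have hmul : mass w (A ∩ B) * mass w (A ∩ B') ≤
      pairMass w (A ∩ B) (A ∩ B') (Set.Iic u) + pairMass w (A ∩ B) (A ∩ B') (Set.Ici v) +
        pairMass w (A ∩ B) (A ∩ B') (Set.Icc u v) := by
    unfold mass pairMass
    rw [Finset.sum_mul_sum, ← Finset.sum_add_distrib, ← Finset.sum_add_distrib]
    refine Finset.sum_le_sum fun σ _ => ?_
    rw [← Finset.sum_add_distrib, ← Finset.sum_add_distrib]
    refine Finset.sum_le_sum fun τ _ => ?_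
    have h0 := mul_nonneg (hw σ) (hw τ)
    simp only [Set.mem_Iic, Set.mem_Ici, Set.mem_Icc]
    by_cases h1 : overlap σ τ ≤ u
    · rw [if_pos h1]
      split_ifs <;> linarith
    · by_cases h2 : v ≤ overlap σ τ
      · rw [if_pos h2]
        split_ifs <;> linarith
      · rw [if_pos (⟨(not_le.1 h1).le, (not_le.1 h2).le⟩ : u ≤ overlap σ τ ∧ overlap σ τ ≤ v)]
        split_ifs <;> linarith
  -- Low overlaps are charged to pairs inside `A`, high ones to `B × B'`, intermediate ones to all
  -- pairs.
  refine hmul.trans (add_le_add (add_le_add ?_ ?_) ?_)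
  · exact pairMass_mono hw Finset.inter_subset_left Finset.inter_subset_left _
  · exact pairMass_mono hw Finset.inter_subset_right Finset.inter_subset_right _
  · exact pairMass_mono hw (Finset.subset_univ _) (Finset.subset_univ _) _

/-- A set of non-negligible mass with small internal separation is almost contained in one member of
a family of well-separated sets carrying most of the mass. -/
theorem exists_mass_sub_le_mass_inter (hw : ∀ σ, 0 ≤ w σ) (h1 : mass w Finset.univ = 1)
    {A : Finset (Config N)} {X : ℕ → Finset (Config N)} {M : ℕ} {u v y η κ ρ : ℝ} (hM : 0 < M)
    (hX : ∀ i j, i ≠ j → Disjoint (X i) (X j))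
    (hA : pairMass w A A (Set.Iic u) ≤ κ)
    (hsep : ∀ i j, i ≠ j → pairMass w (X i) (X j) (Set.Ici v) ≤ κ)
    (hwin : pairMass w Finset.univ Finset.univ (Set.Icc u v) ≤ κ)
    (htail : 1 - η ≤ ∑ i ∈ Finset.range M, mass w (X i)) (hy : 0 < y) (hya : y ≤ mass w A)
    (hsmall : (M : ℝ) ^ 2 * (3 * κ) + 2 * η ≤ ρ * y) :
    ∃ i, mass w A - ρ ≤ mass w (A ∩ X i) := by
  classical
  have hκ : 0 ≤ κ := (pairMass_nonneg hw _ _ _).trans hA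
  have hdX : (↑(Finset.range M) : Set ℕ).PairwiseDisjoint X := fun i _ j _ hij => hX i j hij
  set U := (Finset.range M).biUnion X with hU
  have hUmass : mass w U = ∑ i ∈ Finset.range M, mass w (X i) := by
    unfold mass; rw [hU, Finset.sum_biUnion hdX]
  have hAU : mass w (A ∩ U) = ∑ i ∈ Finset.range M, mass w (A ∩ X i) := by
    unfold mass
    rw [hU, Finset.inter_biUnion, Finset.sum_biUnion]
    exact fun i hi j hj hij => (hdX hi hj hij).mono Finset.inter_subset_right
      Finset.inter_subset_right
  refine exists_sub_le_of_mul_le hM (fun i => mass_nonneg hw _) ?_ ?_ (mass_le_one hw h1 A)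
    (by positivity) (κ := 3 * κ) ?_ hy hya hsmall
  · rw [← hAU]
    exact mass_mono hw Finset.inter_subset_left
  · rw [← hAU]
    have h2 : mass w (A ∩ U) + mass w (A \ U) = mass w A := Finset.sum_inter_add_sum_sdiff A U w
    have h3 : mass w (A \ U) + mass w U = mass w ((A \ U) ∪ U) :=
      (Finset.sum_union Finset.sdiff_disjoint).symm
    have h4 := mass_le_one hw h1 ((A \ U) ∪ U)
    linarith
  · intro i _ j _ hij
    have := mass_inter_mul_mass_inter_le hw A (X i) (X j) u v
    have := hsep i j hij
    linarith

end Mass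


/-! ### The Poisson–Dirichlet weights -/

theorem ae_pos_expSeqLaw : ∀ᵐ e ∂expSeqLaw, ∀ i, 0 < e i := by
  have := isProbabilityMeasure_expMeasure one_pos
  have h0 : ∀ᵐ x ∂expMeasure 1, 0 < x := by
    have h := cdf_expMeasure_eq one_pos 0
    rw [cdf_eq_real] at h
    simp only [le_refl, if_true, mul_zero, neg_zero, Real.exp_zero, sub_self] at h
    rw [measureReal_eq_zero_iff] at h
    rw [ae_iff]
    convert h using 2
    ext x; simp
  rw [ae_all_iff]
  intro i
  exact (measurePreserving_eval_infinitePi (fun _ : ℕ => expMeasure 1) i).quasiMeasurePreserving.ae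
    h0

/-- By the law of large numbers `Γ_n` grows at least linearly, so the points are `O(n ^ (-1/θ))`,
and `1/θ > 1`. -/
theorem ae_summable_poissonPoint {θ : ℝ} (h0 : 0 < θ) (h1 : θ < 1) :
    ∀ᵐ e ∂expSeqLaw, Summable (poissonPoint θ e) := by
  have hprob := isProbabilityMeasure_expMeasure one_pos
  -- Only a lower bound on the sums is needed; truncated variables are integrable at once, and
  -- positivity of their mean suffices.
  set Y : ℕ → (ℕ → ℝ) → ℝ := fun i e => min (e i) 1 with hY
  have hmeas : ∀ i, Measurable (Y i) := fun i => by fun_prop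
  have hpos : ∀ᵐ e ∂expSeqLaw, 0 < Y 0 e := by
    filter_upwards [ae_pos_expSeqLaw] with e he
    exact lt_min (he 0) one_pos
  have hint : Integrable (Y 0) expSeqLaw := by
    refine Integrable.of_bound (hmeas 0).aestronglyMeasurable 1 ?_
    filter_upwards [hpos] with e he
    rw [Real.norm_eq_abs, abs_of_pos he]
    exact min_le_right _ _
  have hmean : 0 < ∫ e, Y 0 e ∂expSeqLaw := by
    rw [integral_pos_iff_support_of_nonneg_ae (hpos.mono fun e he => he.le) hint]
    have : expSeqLaw (Function.support (Y 0)) = 1 := by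
      rw [prob_compl_eq_zero_iff₀ ?_ |>.symm]
      · refine measure_mono_null ?_ hpos
        intro e he
        simp only [Function.mem_support, Set.mem_compl_iff, not_not] at he ⊢
        simp [he]
      · exact ((hmeas 0) (measurableSet_singleton 0)).compl.nullMeasurableSet
    rw [this]; exact one_pos
  have hindep : iIndepFun Y expSeqLaw :=
    iIndepFun_infinitePi (X := fun _ (x : ℝ) => min x 1) (fun _ => by fun_prop)
  have hident : ∀ i, IdentDistrib (Y i) (Y 0) expSeqLaw expSeqLaw := by
    intro i
    have h : IdentDistrib (fun e : ℕ → ℝ => e i) (fun e : ℕ → ℝ => e 0) expSeqLaw expSeqLaw :=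
      ⟨(measurable_pi_apply i).aemeasurable, (measurable_pi_apply 0).aemeasurable,
        ((measurePreserving_eval_infinitePi (fun _ : ℕ => expMeasure 1) i).map_eq).trans
          ((measurePreserving_eval_infinitePi (fun _ : ℕ => expMeasure 1) 0).map_eq).symm⟩
    exact h.comp (u := fun x : ℝ => min x 1) (by fun_prop)
  filter_upwards [strong_law_ae_real Y hint (fun i j hij => hindep.indepFun hij) hident,
    ae_pos_expSeqLaw] with e he hepos
  set c := (∫ e, Y 0 e ∂expSeqLaw) / 2 with hc
  have hcpos : 0 < c := by positivity
  have hev : ∀ᶠ n : ℕ in atTop, c * (n + 1 : ℕ) ≤ ∑ i ∈ Finset.range (n + 1), e i := by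
    have h2 : ∀ᶠ n : ℕ in atTop, c < (∑ i ∈ Finset.range n, Y i e) / n :=
      he.eventually (lt_mem_nhds (half_lt_self hmean))
    filter_upwards [(tendsto_add_atTop_nat 1).eventually h2] with n hn
    have hn' : (0 : ℝ) < (n + 1 : ℕ) := by positivity
    rw [lt_div_iff₀ hn'] at hn
    exact hn.le.trans (Finset.sum_le_sum fun i _ => min_le_left _ _)
  have hsum : Summable fun n : ℕ => c ^ (-1 / θ) * ((n + 1 : ℕ) : ℝ) ^ (-1 / θ) := by
    refine Summable.mul_left _ ?_
    refine (summable_nat_add_iff (f := fun n : ℕ => (n : ℝ) ^ (-1 / θ)) 1).2 ?_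
    rw [Real.summable_nat_rpow, neg_div, neg_lt_neg_iff]
    exact (one_lt_div h0).2 h1
  refine Summable.of_norm_bounded_eventually_nat hsum ?_
  filter_upwards [hev] with n hn
  have hb : 0 < c * (n + 1 : ℕ) := by positivity
  have hs : 0 < ∑ i ∈ Finset.range (n + 1), e i := hb.trans_le hn
  rw [poissonPoint, Real.norm_eq_abs, abs_of_pos (Real.rpow_pos_of_pos hs _),
    ← Real.mul_rpow hcpos.le (by positivity)]
  exact Real.rpow_le_rpow_of_nonpos hb hn
    (div_nonpos_of_nonpos_of_nonneg (by norm_num) h0.le)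

theorem ae_pdWeight {θ : ℝ} (h0 : 0 < θ) (h1 : θ < 1) :
    ∀ᵐ e ∂expSeqLaw, HasSum (pdWeight θ e) 1 ∧ ∀ k, pdWeight θ e (k + 1) < pdWeight θ e k := by
  filter_upwards [ae_pos_expSeqLaw, ae_summable_poissonPoint h0 h1] with e hpos hsum
  have hG : ∀ n, 0 < ∑ i ∈ Finset.range (n + 1), e i := fun n =>
    Finset.sum_pos (fun i _ => hpos i) ⟨0, by simp⟩
  have hpt : ∀ n, 0 < poissonPoint θ e n := fun n => Real.rpow_pos_of_pos (hG n) _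
  have htot : 0 < ∑' k, poissonPoint θ e k := hsum.tsum_pos (fun n => (hpt n).le) 0 (hpt 0)
  refine ⟨?_, fun k => ?_⟩
  · have := hsum.hasSum.div_const (∑' k, poissonPoint θ e k)
    rwa [div_self htot.ne'] at this
  · refine div_lt_div_of_pos_right ?_ htot
    refine Real.rpow_lt_rpow_of_neg (hG k) ?_ (div_neg_of_neg_of_pos (by norm_num) h0)
    rw [Finset.sum_range_succ _ (k + 1)]
    linarith [hpos (k + 1)]

/-- Stated with partial sums, an evidently measurable event that yields the cutoff `M` directly. -/
theorem ae_poissonDirichlet {θ : ℝ} (h0 : 0 < θ) (h1 : θ < 1) :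
    ∀ᵐ x ∂poissonDirichlet θ,
      Tendsto (fun n => ∑ i ∈ Finset.range n, x i) atTop (𝓝 1) ∧ ∀ k, x (k + 1) < x k := by
  rw [poissonDirichlet, if_neg h0.ne']
  refine (ae_map_iff (measurable_pdWeight θ).aemeasurable ?_).2 ?_
  · have hdecr : MeasurableSet {x : ℕ → ℝ | ∀ k, x (k + 1) < x k} := by
      rw [Set.ofPred_forall]
      exact MeasurableSet.iInter fun k => measurableSet_lt (by fun_prop) (by fun_prop)
    exact (measurableSet_tendsto _ fun n => by fun_prop).inter hdecr
  · filter_upwards [ae_pdWeight h0 h1] with e he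
    exact ⟨he.1.tendsto_sum_nat, he.2⟩

theorem ae_poissonDirichlet_zero : ∀ᵐ x ∂poissonDirichlet 0, x = Pi.single 0 1 := by
  rw [poissonDirichlet, if_pos rfl]
  exact (ae_dirac_iff (measurableSet_singleton _)).2 rfl

theorem ae_poissonDirichlet_sum {θ : ℝ} (h0 : 0 ≤ θ) (h1 : θ < 1) :
    ∀ᵐ x ∂poissonDirichlet θ,
      Tendsto (fun n => ∑ i ∈ Finset.range n, x i) atTop (𝓝 1) := by
  rcases h0.eq_or_lt with rfl | h0
  · filter_upwards [ae_poissonDirichlet_zero] with x hx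
    have : HasSum x 1 := hx ▸ hasSum_pi_single 0 1
    exact this.tendsto_sum_nat
  · exact (ae_poissonDirichlet h0 h1).mono fun x hx => hx.1

/-- Up to a small probability, an increasing family of sets that eventually contains almost every
point is reached. -/
theorem exists_measureReal_compl_lt {E : Type*} [MeasurableSpace E] (ν : Measure E)
    [IsProbabilityMeasure ν] {s : ℕ → Set E} (hs : ∀ n, MeasurableSet (s n))
    (h : ∀ᵐ x ∂ν, ∀ᶠ n in atTop, x ∈ s n) {δ : ℝ} (hδ : 0 < δ) :
    ∀ᶠ n in atTop, ν.real (s n)ᶜ < δ := by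
  have h1 : Tendsto (fun n => ν (s n)ᶜ) atTop (𝓝 (ν ∅)) := by
    refine tendsto_measure_of_ae_tendsto_indicator_of_isFiniteMeasure atTop MeasurableSet.empty
      (fun n => (hs n).compl) ?_
    filter_upwards [h] with x hx
    filter_upwards [hx] with n hn
    simpa using hn
  have h2 := (ENNReal.tendsto_toReal (by simp)).comp h1
  simp only [measure_empty, ENNReal.toReal_zero] at h2
  exact h2.eventually (gt_mem_nhds hδ)

/-- Convergence in distribution keeps the laws in an open set charged by the limit. -/
theorem eventually_measureReal_notMem_lt {Ω E : Type*} [MeasurableSpace Ω] {P : Measure Ω}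
    [IsProbabilityMeasure P] [TopologicalSpace E] [MeasurableSpace E] [OpensMeasurableSpace E]
    [HasOuterApproxClosed E] {ν : Measure E} [IsProbabilityMeasure ν] {Y : ℕ → Ω → E}
    (hY : TendstoInDistribution Y atTop (id : E → E) (fun _ => P) ν) {G : Set E} (hG : IsOpen G)
    {δ : ℝ} (h : ν.real Gᶜ < δ) : ∀ᶠ N in atTop, P.real {ω | Y N ω ∉ G} < δ := by
  have h1 := ProbabilityMeasure.limsup_measure_closed_le_of_tendsto hY.tendsto hG.isClosed_compl
  have hδ : 0 < δ := measureReal_nonneg.trans_lt h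
  have h2 : limsup (fun N => (P.map (Y N)) Gᶜ) atTop < ENNReal.ofReal δ := by
    refine lt_of_le_of_lt h1 ?_
    simp only [ProbabilityMeasure.coe_mk, Measure.map_id]
    rw [← ofReal_measureReal]
    exact (ENNReal.ofReal_lt_ofReal_iff hδ).2 h
  filter_upwards [eventually_lt_of_limsup_lt h2] with N hN
  rw [Measure.map_apply_of_aemeasurable (hY.forall_aemeasurable N)
    hG.isClosed_compl.measurableSet] at hN
  exact ENNReal.toReal_lt_of_lt_ofReal hN


/-! ### The Gibbs measure and the overlap distribution -/

theorem gibbs_nonneg {N : ℕ} (h : ℝ) (E : Config N → ℝ) (σ : Config N) : 0 ≤ gibbs h E σ :=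
  div_nonneg (Real.exp_pos _).le (Finset.sum_nonneg fun _ _ => (Real.exp_pos _).le)

theorem mass_gibbs_univ {N : ℕ} (h : ℝ) (E : Config N → ℝ) :
    mass (gibbs h E) Finset.univ = 1 := by
  unfold mass gibbs
  rw [← Finset.sum_div]
  exact div_self (Finset.sum_pos (fun _ _ => Real.exp_pos _) Finset.univ_nonempty).ne'

theorem gibbs_le_one {N : ℕ} (h : ℝ) (E : Config N → ℝ) (σ : Config N) : gibbs h E σ ≤ 1 := by
  have := mass_le_one (gibbs_nonneg h E) (mass_gibbs_univ h E) {σ}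
  simpa [mass] using this

section Law

variable {Ω : Type*} [MeasurableSpace Ω] {P : Measure Ω} [IsProbabilityMeasure P] {h : ℝ}
  {H : (N : ℕ) → Config N → Ω → ℝ}

theorem integrable_gibbs_mul_gibbs (hH : ∀ N σ, AEMeasurable (H N σ) P) (N : ℕ)
    (σ τ : Config N) :
    Integrable (fun ω => gibbs h (fun ρ => H N ρ ω) σ * gibbs h (fun ρ => H N ρ ω) τ) P := by
  have hexp : ∀ ρ : Config N,
      AEMeasurable (fun ω => Real.exp (energy h (fun ρ => H N ρ ω) ρ)) P := fun ρ =>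
    Real.measurable_exp.comp_aemeasurable ((hH N ρ).add_const _)
  have hg : ∀ ρ : Config N, AEMeasurable (fun ω => gibbs h (fun ρ => H N ρ ω) ρ) P := fun ρ =>
    (hexp ρ).div (Finset.aemeasurable_fun_sum _ fun τ _ => hexp τ)
  refine Integrable.of_bound ((hg σ).mul (hg τ)).aestronglyMeasurable 1 (ae_of_all _ fun ω => ?_)
  rw [Real.norm_eq_abs, abs_of_nonneg (mul_nonneg (gibbs_nonneg _ _ _) (gibbs_nonneg _ _ _))]
  exact mul_le_one₀ (gibbs_le_one _ _ _) (gibbs_nonneg _ _ _) (gibbs_le_one _ _ _)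

theorem integrable_pairMass (hH : ∀ N σ, AEMeasurable (H N σ) P) (N : ℕ) (S : Set ℝ) :
    Integrable (fun ω =>
      pairMass (gibbs h (fun ρ => H N ρ ω)) Finset.univ Finset.univ S) P := by
  unfold pairMass
  refine integrable_finsetSum _ fun σ _ => integrable_finsetSum _ fun τ _ => ?_
  split_ifs
  · exact integrable_gibbs_mul_gibbs hH N σ τ
  · exact integrable_zero _ _ _

/-- The overlap distribution is the mean of the distribution of the overlap under the Gibbs
measure. -/
theorem integral_pairMass (hH : ∀ N σ, AEMeasurable (H N σ) P) (N : ℕ) {S : Set ℝ}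
    (hS : MeasurableSet S) :
    ∫ ω, pairMass (gibbs h (fun ρ => H N ρ ω)) Finset.univ Finset.univ S ∂P =
      (overlapLaw P h H N).real S := by
  classical
  have hint : ∀ σ τ : Config N, Integrable (fun ω => if overlap σ τ ∈ S then
      gibbs h (fun ρ => H N ρ ω) σ * gibbs h (fun ρ => H N ρ ω) τ else 0) P := fun σ τ => by
    split_ifs
    · exact integrable_gibbs_mul_gibbs hH N σ τ
    · exact integrable_zero _ _ _
  have hlaw : (overlapLaw P h H N).real S = ∑ σ : Config N, ∑ τ : Config N,
      ∫ ω, (if overlap σ τ ∈ S then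
        gibbs h (fun ρ => H N ρ ω) σ * gibbs h (fun ρ => H N ρ ω) τ else 0) ∂P := by
    have hterm : ∀ σ τ : Config N,
        (ENNReal.ofReal (∫ ω, gibbs h (fun ρ => H N ρ ω) σ * gibbs h (fun ρ => H N ρ ω) τ ∂P) •
          Measure.dirac (overlap σ τ)) S = ENNReal.ofReal (∫ ω, (if overlap σ τ ∈ S then
        gibbs h (fun ρ => H N ρ ω) σ * gibbs h (fun ρ => H N ρ ω) τ else 0) ∂P) := by
      intro σ τ
      rw [Measure.smul_apply, Measure.dirac_apply' _ hS]
      by_cases hστ : overlap σ τ ∈ S <;> simp [hστ]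
    have hnn : ∀ σ τ : Config N, 0 ≤ ∫ ω, (if overlap σ τ ∈ S then
        gibbs h (fun ρ => H N ρ ω) σ * gibbs h (fun ρ => H N ρ ω) τ else 0) ∂P := fun σ τ => by
      refine integral_nonneg fun ω => ?_
      dsimp only
      split_ifs
      · exact mul_nonneg (gibbs_nonneg _ _ _) (gibbs_nonneg _ _ _)
      · exact le_rfl
    have hENN : overlapLaw P h H N S = ENNReal.ofReal (∑ σ : Config N, ∑ τ : Config N,
        ∫ ω, (if overlap σ τ ∈ S then
          gibbs h (fun ρ => H N ρ ω) σ * gibbs h (fun ρ => H N ρ ω) τ else 0) ∂P) := by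
      rw [ENNReal.ofReal_sum_of_nonneg fun σ _ => Finset.sum_nonneg fun τ _ => hnn σ τ]
      simp only [overlapLaw, Measure.coe_finsetSum, Finset.sum_apply, hterm]
      exact Finset.sum_congr rfl fun σ _ =>
        (ENNReal.ofReal_sum_of_nonneg fun τ _ => hnn σ τ).symm
    rw [Measure.real, hENN, ENNReal.toReal_ofReal]
    exact Finset.sum_nonneg fun σ _ => Finset.sum_nonneg fun τ _ => hnn σ τ
  rw [hlaw]
  unfold pairMass
  rw [integral_finsetSum _ fun σ _ => integrable_finsetSum _ fun τ _ => by convert hint σ τ]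
  refine Finset.sum_congr rfl fun σ _ => ?_
  rw [integral_finsetSum _ fun τ _ => by convert hint σ τ]

/-- Markov's inequality, the mean being given by `integral_pairMass`. It turns the window hypothesis
on `ζ_N` into a bound for typical disorder. -/
theorem tendsto_measureReal_pairMass_ge (hH : ∀ N σ, AEMeasurable (H N σ) P) {S : ℕ → Set ℝ}
    (hS : ∀ N, MeasurableSet (S N))
    (hlim : Tendsto (fun N => (overlapLaw P h H N).real (S N)) atTop (𝓝 0)) {κ : ℝ} (hκ : 0 < κ) :
    Tendsto (fun N => P.real {ω | κ ≤
      pairMass (gibbs h (fun ρ => H N ρ ω)) Finset.univ Finset.univ (S N)}) atTop (𝓝 0) := by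
  have hbound : Tendsto (fun N => (overlapLaw P h H N).real (S N) / κ) atTop (𝓝 0) := by
    simpa using hlim.div_const κ
  refine squeeze_zero (fun N => measureReal_nonneg) (fun N => ?_) hbound
  rw [le_div_iff₀ hκ, mul_comm, ← integral_pairMass hH N (hS N)]
  exact mul_meas_ge_le_integral_of_nonneg
    (ae_of_all _ fun ω => pairMass_nonneg (gibbs_nonneg _ _) _ _ _)
    (integrable_pairMass hH N (S N)) κ

end Law

/-! ### Comparison of two families of clusters -/

/-- Deterministic comparison of two families of clusters at close scales. -/
theorem ClusterProperties.mass_symmDiff_le {N : ℕ} {w : Config N → ℝ} (hw : ∀ σ, 0 ≤ w σ)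
    (h1 : mass w Finset.univ = 1) {s s' : Scales} {qs δ δ' : ℝ} {C X : ℕ → Finset (Config N)}
    (hC : ClusterProperties w s qs δ C) (hX : ClusterProperties w s' qs δ' X) {M α : ℕ}
    {g η κ ρ : ℝ} (hM : 0 < M) (hb : s.b N ≤ κ) (hb' : s'.b N ≤ κ)
    (hwin : pairMass w Finset.univ Finset.univ (Set.Icc (s'.q N - s'.a N) (s.q N + s.a N)) ≤ κ)
    (hwin' : pairMass w Finset.univ Finset.univ (Set.Icc (s.q N - s.a N) (s'.q N + s'.a N)) ≤ κ)
    (htail : 1 - η ≤ ∑ i ∈ Finset.range M, mass w (C i))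
    (htail' : 1 - η ≤ ∑ i ∈ Finset.range M, mass w (X i))
    (hgap : ∀ k ≤ α, g ≤ mass w (C k) - mass w (C (k + 1))) (hρ : 0 < ρ) (hρg : 4 * ρ < g)
    (hsmall : (M : ℝ) ^ 2 * (3 * κ) + 2 * η ≤ ρ * (g / 2)) :
    mass w (C α ∆ X α) ≤ 2 * ρ := by
  have hg : 0 < g / 2 := by linarith
  have key := diagonal_matching (m := fun k j => mass w (C k ∩ X j))
    (c := fun k => mass w (C k)) (x := fun k => mass w (X k)) (g := g) (ρ := ρ) (α := α)
    (fun k j => mass_nonneg hw _)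
    (fun k i j hij => mass_inter_add_le hw _ (hX.disjoint i j hij))
    (fun j k l hkl => by
      rw [Finset.inter_comm (C k), Finset.inter_comm (C l)]
      exact mass_inter_add_le hw _ (hC.disjoint k l hkl))
    hC.ordered hX.ordered
    (fun k hk => exists_mass_sub_le_mass_inter hw h1 hM hX.disjoint ((hC.close k).trans hb)
      (fun i j hij => (hX.separated i j hij).trans hb') hwin' htail' hg hk hsmall)
    (fun j hj => by
      simp only [Finset.inter_comm _ (X j)]
      exact exists_mass_sub_le_mass_inter hw h1 hM hC.disjoint ((hX.close j).trans hb')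
        (fun i j hij => (hC.separated i j hij).trans hb) hwin htail hg hj hsmall)
    hgap hρ hρg α le_rfl
  rw [mass_symmDiff]
  linarith [key.1, key.2]

section Collection

variable {Ω : Type*} [MeasurableSpace Ω] {P : Measure Ω} [IsProbabilityMeasure P] {h : ℝ}
  {H : (N : ℕ) → Config N → Ω → ℝ} {ζ : Measure ℝ} {s s' : Scales}
  {C X : (N : ℕ) → ℕ → Ω → Finset (Config N)}

theorem isOpen_sum_range_gt (M : ℕ) (r : ℝ) :
    IsOpen {x : ℕ → ℝ | r < ∑ i ∈ Finset.range M, x i} :=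
  isOpen_lt continuous_const (by fun_prop)

/-- Finitely many clusters carry most of the mass. -/
theorem IsClusterCollection.eventually_tail_lt (hC : IsClusterCollection P h H ζ s C) {M : ℕ}
    {r δ : ℝ} (hM : (poissonDirichlet (1 - ζ.real {qStar ζ})).real
      {x : ℕ → ℝ | r < ∑ i ∈ Finset.range M, x i}ᶜ < δ) :
    ∀ᶠ N in atTop, P.real {ω | ¬ r <
      ∑ i ∈ Finset.range M, mass (gibbs h (fun ρ => H N ρ ω)) (C N i ω)} < δ :=
  eventually_measureReal_notMem_lt hC.weights (isOpen_sum_range_gt M r) hM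

/-- The clusters are the same, up to a small mass, at every rank below which the limiting weights are
strictly decreasing. -/
theorem eventually_measureReal_symmDiff_lt (hH : ∀ N σ, AEMeasurable (H N σ) P)
    (hC : IsClusterCollection P h H ζ s C) (hX : IsClusterCollection P h H ζ s' X)
    (hwin : Tendsto (fun N =>
      (overlapLaw P h H N).real (Set.Icc (s'.q N - s'.a N) (s.q N + s.a N))) atTop (𝓝 0))
    (hwin' : Tendsto (fun N =>
      (overlapLaw P h H N).real (Set.Icc (s.q N - s.a N) (s'.q N + s'.a N))) atTop (𝓝 0))
    {α : ℕ}
    (hsum : ∀ᵐ x ∂poissonDirichlet (1 - ζ.real {qStar ζ}),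
      Tendsto (fun n => ∑ i ∈ Finset.range n, x i) atTop (𝓝 1))
    (hdecr : ∀ᵐ x ∂poissonDirichlet (1 - ζ.real {qStar ζ}), ∀ k ≤ α, x (k + 1) < x k)
    {ε δ : ℝ} (hε : 0 < ε) (hδ : 0 < δ) :
    ∀ᶠ N in atTop,
      P.real {ω | ε ≤ mass (gibbs h (fun ρ => H N ρ ω)) (C N α ω ∆ X N α ω)} < δ := by
  set ν := poissonDirichlet (1 - ζ.real {qStar ζ}) with hν
  -- Seven bad events: two failures of the cluster properties, one of the gap, two heavy tails, two
  -- heavy windows.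
  have hδ7 : 0 < δ / 7 := by positivity
  -- a definite gap between the first weights
  have hGopen : ∀ n : ℕ,
      IsOpen {x : ℕ → ℝ | ∀ k ∈ Finset.range (α + 1), 1 / ((n : ℝ) + 1) < x k - x (k + 1)} := by
    intro n
    simp only [Set.ofPred_forall]
    exact isOpen_biInter_finset fun k _ => isOpen_lt continuous_const (by fun_prop)
  obtain ⟨n, hn⟩ := (exists_measureReal_compl_lt ν (fun n => (hGopen n).measurableSet) (by
    filter_upwards [hdecr] with x hx
    refine (Filter.eventually_all_finset _).2 fun k hk => ?_
    have : 0 < x k - x (k + 1) := sub_pos.2 (hx k (by simpa [Nat.lt_succ_iff] using hk))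
    exact tendsto_one_div_add_atTop_nhds_zero_nat.eventually (gt_mem_nhds this)) hδ7).exists
  set g : ℝ := 1 / ((n : ℝ) + 1) with hg
  have hg0 : 0 < g := by positivity
  -- `ε / 4` makes the final bound `2ρ` smaller than `ε`; `g / 8` gives `4ρ < g`.
  set ρ : ℝ := min (ε / 4) (g / 8) with hρ
  have hρ0 : 0 < ρ := lt_min (by positivity) (by positivity)
  have hρε : ρ ≤ ε / 4 := min_le_left _ _
  have hρg : ρ ≤ g / 8 := min_le_right _ _
  -- The budget `ρ * (g / 2)` is split equally between `2η` and `3 M² κ`. As `η` fixes `M`, `κ` is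
  -- chosen last, all before `N`.
  set η : ℝ := ρ * g / 8 with hη
  have hη0 : 0 < η := by positivity
  obtain ⟨M, hM, hM0⟩ := ((exists_measureReal_compl_lt ν
    (s := fun M => {x : ℕ → ℝ | 1 - η < ∑ i ∈ Finset.range M, x i})
    (fun M => (isOpen_sum_range_gt M (1 - η)).measurableSet) (by
      filter_upwards [hsum] with x hx
      exact hx.eventually (lt_mem_nhds (by linarith))) hδ7).and (eventually_gt_atTop 0)).exists
  have hMpos : (0 : ℝ) < M := Nat.cast_pos.2 hM0
  set κ : ℝ := ρ * g / (12 * (M : ℝ) ^ 2) with hκ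
  have hκ0 : 0 < κ := by positivity
  have hsmall : (M : ℝ) ^ 2 * (3 * κ) + 2 * η ≤ ρ * (g / 2) := by
    have : (M : ℝ) ^ 2 * (3 * κ) = ρ * g / 4 := by
      rw [hκ]; field_simp; norm_num
    rw [this, hη]; linarith
  obtain ⟨d, -, hd⟩ := hC.whp
  obtain ⟨d', -, hd'⟩ := hX.whp
  have hreal : ∀ {B : ℕ → Set Ω}, Tendsto (fun N => P (B N)) atTop (𝓝 0) →
      ∀ᶠ N in atTop, P.real (B N) < δ / 7 := fun hB =>
    ((ENNReal.tendsto_toReal (by simp)).comp hB).eventually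
      (gt_mem_nhds (by simpa using hδ7))
  filter_upwards [hreal hd, hreal hd', eventually_measureReal_notMem_lt hC.weights (hGopen n) hn,
    hC.eventually_tail_lt hM, hX.eventually_tail_lt hM,
    (tendsto_measureReal_pairMass_ge hH (fun N => measurableSet_Icc) hwin hκ0).eventually
      (gt_mem_nhds hδ7),
    (tendsto_measureReal_pairMass_ge hH (fun N => measurableSet_Icc) hwin' hκ0).eventually
      (gt_mem_nhds hδ7),
    hC.admissible.b_tendsto.eventually (gt_mem_nhds hκ0),
    hX.admissible.b_tendsto.eventually (gt_mem_nhds hκ0)] with N e1 e2 e3 e4 e5 e6 e7 hb hb'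
  have hunion : ∀ {U V : Set Ω} {a b : ℝ}, P.real U < a → P.real V < b →
      P.real (U ∪ V) < a + b := fun hU hV => (measureReal_union_le _ _).trans_lt (add_lt_add hU hV)
  refine lt_of_le_of_lt (measureReal_mono ?_) ((hunion (hunion (hunion (hunion (hunion
    (hunion e1 e2) e3) e4) e5) e6) e7).trans_eq (by ring))
  intro ω hω
  by_contra hgood
  simp only [Set.mem_union, Set.mem_ofPred_eq, not_or, not_not, not_le] at hgood
  obtain ⟨⟨⟨⟨⟨⟨g1, g2⟩, g3⟩, g4⟩, g5⟩, g6⟩, g7⟩ := hgood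
  have := ClusterProperties.mass_symmDiff_le (gibbs_nonneg _ _) (mass_gibbs_univ _ _) g1 g2 hM0
    hb.le hb'.le g6.le g7.le g4.le g5.le
    (fun k hk => (g3 k (by simpa [Nat.lt_succ_iff] using hk)).le) hρ0 (by linarith) hsmall
  have hω' : ε ≤ mass (gibbs h (fun ρ => H N ρ ω)) (C N α ω ∆ X N α ω) := hω
  linarith

/-- If the limiting weights are concentrated on the first one, the other clusters are negligible. -/
theorem eventually_measureReal_mass_succ_lt (hC : IsClusterCollection P h H ζ s C)
    (hθ : ∀ᵐ x ∂poissonDirichlet (1 - ζ.real {qStar ζ}), x = Pi.single 0 1) {α : ℕ} (hα : α ≠ 0)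
    {ε δ : ℝ} (hε : 0 < ε) (hδ : 0 < δ) :
    ∀ᶠ N in atTop, P.real {ω | ε ≤ mass (gibbs h (fun ρ => H N ρ ω)) (C N α ω)} < δ := by
  have hopen : IsOpen {x : ℕ → ℝ | x α < ε} := isOpen_lt (by fun_prop) continuous_const
  have := eventually_measureReal_notMem_lt hC.weights hopen (δ := δ) (by
    refine lt_of_eq_of_lt ?_ hδ
    rw [measureReal_eq_zero_iff, ← mem_ae_iff]
    filter_upwards [hθ] with x hx
    simpa [hx, hα] using hε)
  simpa using this

end Collection

end SpinGlass

open SpinGlass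
-- The jump at `q_*` gives `θ < 1`. The cases `θ = 0` and `θ > 0` differ only in the ranks at which
-- the limiting weights strictly decrease.
theorem mainTheorem5 {Ω : Type*} [MeasurableSpace Ω] (P : Measure Ω) [IsProbabilityMeasure P]
    (β : ℕ → ℝ) (h : ℝ) (H : (N : ℕ) → Config N → Ω → ℝ) (hH : IsGenericMixedPSpin P β H)
    (ζ : Measure ℝ) [IsProbabilityMeasure ζ] (hζ : IsLimitingOverlapLaw P h H ζ)
    (hjump : 0 < ζ {qStar ζ})
    (s s' : Scales) (C X : (N : ℕ) → ℕ → Ω → Finset (Config N))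
    (hC : IsClusterCollection P h H ζ s C) (hX : IsClusterCollection P h H ζ s' X)
    (hwindow : Tendsto (fun N =>
      (overlapLaw P h H N).real (Set.Icc (s'.q N - s'.a N) (s.q N + s.a N)) +
        (overlapLaw P h H N).real (Set.Icc (s.q N - s.a N) (s'.q N + s'.a N)))
      atTop (𝓝 0)) (α : ℕ) :
    TendstoInMeasure P
      (fun N ω => mass (gibbs h (fun ρ => H N ρ ω)) (C N α ω ∆ X N α ω)) atTop
      (fun _ => 0) := by
  have hmeas : ∀ N σ, AEMeasurable (H N σ) P := fun N σ => (hH.gaussian N).aemeasurable σ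
  have hwin := squeeze_zero (fun N => measureReal_nonneg)
    (fun N => le_add_of_nonneg_right measureReal_nonneg) hwindow
  have hwin' := squeeze_zero (fun N => measureReal_nonneg)
    (fun N => le_add_of_nonneg_left measureReal_nonneg) hwindow
  have hθ0 : 0 ≤ 1 - ζ.real {qStar ζ} := sub_nonneg.2 measureReal_le_one
  have hθ1 : 1 - ζ.real {qStar ζ} < 1 := by
    have : 0 < ζ.real {qStar ζ} := ENNReal.toReal_pos hjump.ne' (measure_ne_top _ _)
    linarith
  have hsum := ae_poissonDirichlet_sum hθ0 hθ1
  rw [tendstoInMeasure_iff_measureReal_dist]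
  intro ε hε
  simp only [Real.dist_eq, sub_zero, abs_of_nonneg (mass_nonneg (gibbs_nonneg _ _) _)]
  refine tendsto_order.2 ⟨fun δ hδ => Eventually.of_forall fun N =>
    hδ.trans_le measureReal_nonneg, fun δ hδ => ?_⟩
  rcases hθ0.eq_or_lt with hθ | hθ
  · have hsingle : ∀ᵐ x ∂poissonDirichlet (1 - ζ.real {qStar ζ}), x = Pi.single 0 1 :=
      hθ ▸ ae_poissonDirichlet_zero
    rcases eq_or_ne α 0 with rfl | hα
    · refine eventually_measureReal_symmDiff_lt hmeas hC hX hwin hwin' hsum ?_ hε hδ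
      filter_upwards [hsingle] with x hx k hk
      obtain rfl := Nat.le_zero.1 hk
      simp [hx]
    · filter_upwards [eventually_measureReal_mass_succ_lt hC hsingle hα (half_pos hε)
          (half_pos hδ), eventually_measureReal_mass_succ_lt hX hsingle hα (half_pos hε)
          (half_pos hδ)] with N h1 h2
      -- The symmetric difference weighs at most `μ(C_α) + μ(X_α)`, so one of the two masses reaches
      -- `ε / 2`.
      refine lt_of_le_of_lt ((measureReal_mono (h₂ := by finiteness) fun ω hω => ?_).trans
        (measureReal_union_le _ _)) ((add_lt_add h1 h2).trans_eq (add_halves δ))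
      by_contra hgood
      simp only [Set.mem_union, Set.mem_ofPred_eq, not_or, not_le] at hgood hω
      rw [mass_symmDiff] at hω
      have := mass_nonneg (gibbs_nonneg h (fun ρ => H N ρ ω)) (C N α ω ∩ X N α ω)
      linarith [hgood.1, hgood.2]
  · exact eventually_measureReal_symmDiff_lt hmeas hC hX hwin hwin' hsum
      ((ae_poissonDirichlet hθ hθ1).mono fun x hx k _ => hx.2 k) hε hδ
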